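/- Consider batteries made of $n$ two-level cells, each with Hamiltonian $\hat h=|1\rangle\langle 1|$, and let $\hat H^{(n)}=\hat h_1+\dots+\hat h_n$ be the total Hamiltonian. For a state $\hat\rho$ and a Hamiltonian $\hat H$ let $$\mathcal E(\hat\rho;\hat H)=\max_{\hat U\ \mathrm{unitary}}\big\{\mathrm{Tr}[\hat\rho\hat H]-\mathrm{Tr}[\hat U\hat\rho\,\hat U^\dagger\hat H]\big\}$$ be the ergotropy. For a qubit channel $\Lambda$ let $\mathcal E^{(n)}_{\rm sep}(\Lambda;E)$ be the maximum of $\mathcal E(\Lambda^{\otimes n}(\hat\rho);\hat H^{(n)})$ over all (fully) separable $n$-cell states $\hat\rho$ with $\mathrm{Tr}[\hat\rho\hat H^{(n)}]\le E$, and let $$C_{\rm sep}(\Lambda;\mathfrak e)=\lim_{n\to\infty}\frac{\mathcal E^{(n)}_{\rm sep}(\Lambda;n\mathfrak e)}{n}$$ be the separable-input ergotropic capacitance. Let $\mathcal E^{(1)}(\Lambda;\mathfrak e)$ be the maximum of $\mathcal E(\Lambda(\hat\rho);\hat h)$ over all one-cell states $\hat\rho$ with $\mathrm{Tr}[\hat\rho\hat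 h]\le\mathfrak e$, and let $$\chi(\Lambda;\mathfrak e)=\sup\sum_j p_j\,\mathcal E^{(1)}(\Lambda;\mathfrak e_j),$$ the supremum being over all finite probability distributions $\{p_j,\mathfrak e_j\}$ of energies $\mathfrak e_j\in[0,1]$ with $\sum_j p_j\mathfrak e_j\le\mathfrak e$. For $\gamma\in[0,1]$ and $\eta\in[0,1/2]$ the generalized amplitude damping channel acts on qubit density matrices as $$\Phi_{\gamma,\eta}(\hat\rho)=\begin{pmatrix}1-\gamma\eta-(1-\gamma)\rho_{11}&\sqrt{1-\gamma}\,\rho_{01}\\ \sqrt{1-\gamma}\,\rho_{10}&\gamma\eta+(1-\gamma)\rho_{11}\end{pmatrix},$$ and the amplitude damping channel as $$\Phi_{\gamma}(\hat\rho)=\begin{pmatrix}\rho_{00}+\gamma\rho_{11}&\sqrt{1-\gamma}\,\rho_{01}\\ \sqrt{1-\gamma}\,\rho_{10}&(1-\gamma)\rho_{11}\end{pmatrix}.$$ Then for all $\gamma\in[0,1]$, $\eta\in[0,1/2]$ and $\mathfrak e\in[0,1]$ the limits that define $C_{\rm sep}(\Phi_{\gamma,\eta};\mathfrak e)$ and $C_{\rm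 sep}(\Phi_\gamma;\mathfrak e)$ exist, and $$C_{\rm sep}(\Phi_{\gamma,\eta};\mathfrak e)=\chi(\Phi_{\gamma,\eta};\mathfrak e),\qquad C_{\rm sep}(\Phi_{\gamma};\mathfrak e)=\chi(\Phi_{\gamma};\mathfrak e).$$ -/

import Mathlib

open Filter Topology
open scoped ComplexOrder

namespace QBattery

noncomputable section

/-- Density matrices: positive semidefinite, of trace one. -/
def IsDensity {m : Type*} [Fintype m] (ρ : Matrix m m ℂ) : Prop :=
  ρ.PosSemidef ∧ ρ.trace = 1

/-- Mean energy `Tr[ρ H]`. -/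
def energy {m : Type*} [Fintype m] (ρ H : Matrix m m ℂ) : ℝ :=
  (ρ * H).trace.re

/-- Ergotropy: the maximum over all unitaries `U` of `Tr[ρ H] - Tr[U ρ U† H]`. -/
def ergotropy {m : Type*} [Fintype m] [DecidableEq m] (ρ H : Matrix m m ℂ) : ℝ :=
  sSup {w : ℝ | ∃ U ∈ Matrix.unitaryGroup m ℂ,
    w = energy ρ H - energy (U * ρ * U.conjTranspose) H}

/-- The tensor product `σ₁ ⊗ ⋯ ⊗ σₙ`, in the product basis of the `n` cells, which is indexed
by the functions `Fin n → m`. -/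
def tensor {m : Type*} {n : ℕ} (σ : Fin n → Matrix m m ℂ) :
    Matrix (Fin n → m) (Fin n → m) ℂ :=
  Matrix.of fun i j => ∏ t, σ t (i t) (j t)

/-- The Hamiltonian `h₁ + ⋯ + hₙ` of `n` non-interacting cells with local Hamiltonian `h`;
the `t`-th term acts as `h` on cell `t` and as the identity on all other cells. -/
def totalHamiltonian {m : Type*} [DecidableEq m] (h : Matrix m m ℂ) (n : ℕ) :
    Matrix (Fin n → m) (Fin n → m) ℂ :=
  ∑ t : Fin n, tensor (Function.update (fun _ => (1 : Matrix m m ℂ)) t h)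

/-- The map `Λ ⊗ ⋯ ⊗ Λ` (`n` factors): the linear map that sends each product matrix unit
`E_{k₁ l₁} ⊗ ⋯ ⊗ E_{kₙ lₙ}` to `Λ(E_{k₁ l₁}) ⊗ ⋯ ⊗ Λ(E_{kₙ lₙ})`. -/
def tensorPow {m : Type*} [Fintype m] [DecidableEq m]
    (Λ : Matrix m m ℂ →ₗ[ℂ] Matrix m m ℂ) (n : ℕ)
    (ρ : Matrix (Fin n → m) (Fin n → m) ℂ) : Matrix (Fin n → m) (Fin n → m) ℂ :=
  ∑ k, ∑ l, ρ k l • tensor fun t => Λ (Matrix.single (k t) (l t) (1 : ℂ))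

/-- On a product matrix the map `Λ ⊗ ⋯ ⊗ Λ` acts factor by factor. -/
theorem tensorPow_tensor {m : Type*} [Fintype m] [DecidableEq m]
    (Λ : Matrix m m ℂ →ₗ[ℂ] Matrix m m ℂ) (n : ℕ) (σ : Fin n → Matrix m m ℂ) :
    tensorPow Λ n (tensor σ) = tensor fun t => Λ (σ t) := by
  have key : ∀ (A : Matrix m m ℂ) (a b : m),
      Λ A a b = ∑ x : m × m, A x.1 x.2 * Λ (Matrix.single x.1 x.2 (1 : ℂ)) a b := by
    intro A a b
    conv_lhs => rw [Matrix.matrix_eq_sum_single A]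
    rw [Fintype.sum_prod_type]
    simp only [map_sum, Matrix.sum_apply]
    refine Finset.sum_congr rfl fun x _ => Finset.sum_congr rfl fun y _ => ?_
    have : Matrix.single x y (A x y) = A x y • Matrix.single x y (1 : ℂ) := by
      simp [Matrix.smul_single]
    rw [this, map_smul]; rfl
  ext i j
  simp only [tensorPow, tensor, Matrix.sum_apply, Matrix.smul_apply, Matrix.of_apply,
    smul_eq_mul, ← Finset.prod_mul_distrib]
  rw [Finset.prod_congr rfl fun t _ => key (σ t) (i t) (j t), Finset.prod_univ_sum,
    Fintype.piFinset_univ, ← Fintype.sum_prod_type'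
      (fun (k l : Fin n → m) => ∏ t, σ t (k t) (l t) *
        Λ (Matrix.single (k t) (l t) (1 : ℂ)) (i t) (j t))]
  exact (Equiv.sum_comp (Equiv.arrowProdEquivProdArrow (Fin n) (fun _ => m) (fun _ => m))
    (fun x : (Fin n → m) × (Fin n → m) => ∏ t, σ t (x.1 t) (x.2 t) *
        Λ (Matrix.single (x.1 t) (x.2 t) (1 : ℂ)) (i t) (j t))).symm

/-- Separable states of `n` cells: convex combinations of products of density matrices. -/
def IsSeparable {m : Type*} [Fintype m] {n : ℕ}
    (ρ : Matrix (Fin n → m) (Fin n → m) ℂ) : Prop :=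
  ρ ∈ convexHull ℝ {τ | ∃ σ : Fin n → Matrix m m ℂ, (∀ t, IsDensity (σ t)) ∧ τ = tensor σ}

/-- Maximum ergotropy at the output of `n` uses of `Λ`, over all separable input states of mean
energy at most `E`. -/
def maxErgotropySep {m : Type*} [Fintype m] [DecidableEq m]
    (Λ : Matrix m m ℂ →ₗ[ℂ] Matrix m m ℂ) (h : Matrix m m ℂ) (n : ℕ) (E : ℝ) : ℝ :=
  sSup {w : ℝ | ∃ ρ : Matrix (Fin n → m) (Fin n → m) ℂ, IsSeparable ρ ∧
    energy ρ (totalHamiltonian h n) ≤ E ∧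
    w = ergotropy (tensorPow Λ n ρ) (totalHamiltonian h n)}

/-- The separable-input ergotropic capacitance: the limit for `n → ∞` of the maximum output
ergotropy per cell, at input energy at most `n 𝔢`. -/
def sepCapacitance {m : Type*} [Fintype m] [DecidableEq m]
    (Λ : Matrix m m ℂ →ₗ[ℂ] Matrix m m ℂ) (h : Matrix m m ℂ) (e : ℝ) : ℝ :=
  limUnder atTop fun n : ℕ => maxErgotropySep Λ h n (n * e) / n

/-- Maximum ergotropy at the output of a single use of `Λ`, over all states of one cell of mean
energy at most `E`. -/
def maxErgotropyOne {m : Type*} [Fintype m] [DecidableEq m]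
    (Λ : Matrix m m ℂ →ₗ[ℂ] Matrix m m ℂ) (h : Matrix m m ℂ) (E : ℝ) : ℝ :=
  sSup {w : ℝ | ∃ ρ : Matrix m m ℂ, IsDensity ρ ∧ energy ρ h ≤ E ∧ w = ergotropy (Λ ρ) h}

/-- `χ(Λ; 𝔢)`: the supremum of `∑ pⱼ 𝓔⁽¹⁾(Λ; 𝔢ⱼ)` over the finite probability distributions
`{pⱼ, 𝔢ⱼ}` of cell energies `𝔢ⱼ ∈ [0, 1]` with `∑ pⱼ 𝔢ⱼ ≤ 𝔢`. -/
def chi {m : Type*} [Fintype m] [DecidableEq m]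
    (Λ : Matrix m m ℂ →ₗ[ℂ] Matrix m m ℂ) (h : Matrix m m ℂ) (e : ℝ) : ℝ :=
  sSup {x : ℝ | ∃ (k : ℕ) (p ε : Fin k → ℝ), (∀ j, 0 ≤ p j) ∧ ∑ j, p j = 1 ∧
    (∀ j, ε j ∈ Set.Icc (0 : ℝ) 1) ∧ ∑ j, p j * ε j ≤ e ∧
    x = ∑ j, p j * maxErgotropyOne Λ h (ε j)}

/-- The qubit Hamiltonian `|1⟩⟨1|`. -/
def qubitHamiltonian : Matrix (Fin 2) (Fin 2) ℂ :=
  !![0, 0; 0, 1]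

/-- The amplitude damping channel `Φ_γ`. -/
def adc (γ : ℝ) : Matrix (Fin 2) (Fin 2) ℂ →ₗ[ℂ] Matrix (Fin 2) (Fin 2) ℂ where
  toFun ρ := !![ρ 0 0 + (γ : ℂ) * ρ 1 1, (√(1 - γ) : ℂ) * ρ 0 1;
                (√(1 - γ) : ℂ) * ρ 1 0, (1 - (γ : ℂ)) * ρ 1 1]
  map_add' ρ σ := by
    ext i j
    fin_cases i <;> fin_cases j <;> simp <;> ring
  map_smul' c ρ := by
    ext i j
    fin_cases i <;> fin_cases j <;> simp <;> ring

/-- The generalized amplitude damping channel `Φ_{γ,η}`, as a linear map: the constants of the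
usual formula for density matrices are multiplied by `Tr ρ` (see `gadc_of_trace_eq_one`). -/
def gadc (γ η : ℝ) : Matrix (Fin 2) (Fin 2) ℂ →ₗ[ℂ] Matrix (Fin 2) (Fin 2) ℂ where
  toFun ρ := !![(1 - (γ : ℂ) * η) * ρ.trace - (1 - (γ : ℂ)) * ρ 1 1, (√(1 - γ) : ℂ) * ρ 0 1;
                (√(1 - γ) : ℂ) * ρ 1 0, (γ : ℂ) * η * ρ.trace + (1 - (γ : ℂ)) * ρ 1 1]
  map_add' ρ σ := by
    ext i j
    fin_cases i <;> fin_cases j <;> simp <;> ring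
  map_smul' c ρ := by
    ext i j
    fin_cases i <;> fin_cases j <;> simp <;> ring

theorem gadc_of_trace_eq_one (γ η : ℝ) (ρ : Matrix (Fin 2) (Fin 2) ℂ) (hρ : ρ.trace = 1) :
    gadc γ η ρ =
      !![1 - (γ : ℂ) * η - (1 - (γ : ℂ)) * ρ 1 1, (√(1 - γ) : ℂ) * ρ 0 1;
         (√(1 - γ) : ℂ) * ρ 1 0, (γ : ℂ) * η + (1 - (γ : ℂ)) * ρ 1 1] := by
  simp [gadc, hρ]

theorem gadc_zero (γ : ℝ) : gadc γ 0 = adc γ := by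
  ext ρ i j
  fin_cases i <;> fin_cases j <;> simp [gadc, adc, Matrix.trace_fin_two]
  ring

end

end QBattery

/-!
A unitary preserves the entropy, so by Gibbs' variational principle it cannot bring `n` cells below
the energy of `n` thermal cells with the same total entropy. The entropy of a qubit is an
increasing, convex function of its concurrence `2 √det`. At a given input energy the output
concurrence of the damping channel is least on pure states, and that least value is convex in the
energy, being the norm of an affine function. Hence a product input does no better than `n` copies
of one pure state with the average energy. The resulting bound on the extracted work is concave in
the energy; it therefore extends to mixtures of product states, and it makes `χ` equal to the
one-cell optimum.
-/

namespace QBattery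

open Real (binEntropy negMulLog)
open scoped Matrix

section Tensor

variable {m : Type*} {n : ℕ}

theorem tensor_conjTranspose (σ : Fin n → Matrix m m ℂ) :
    (tensor σ)ᴴ = tensor fun t => (σ t)ᴴ := by
  ext i j
  simp [tensor, Matrix.conjTranspose_apply, star_prod]

theorem tensor_diagonal [DecidableEq m] (d : Fin n → m → ℂ) :
    tensor (fun t => Matrix.diagonal (d t)) = Matrix.diagonal fun i => ∏ t, d t (i t) := by
  ext i j
  by_cases h : i = j
  · subst h; simp [tensor]
  · obtain ⟨t, ht⟩ := Function.ne_iff.mp h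
    rw [Matrix.diagonal_apply_ne _ h]
    exact Finset.prod_eq_zero (Finset.mem_univ t) (Matrix.diagonal_apply_ne _ ht)

theorem tensor_one [DecidableEq m] : tensor (fun _ : Fin n => (1 : Matrix m m ℂ)) = 1 := by
  simpa using tensor_diagonal (fun (_ : Fin n) (_ : m) => (1 : ℂ))

theorem totalHamiltonian_diagonal [DecidableEq m] (v : m → ℂ) :
    totalHamiltonian (Matrix.diagonal v) n = Matrix.diagonal fun i => ∑ t, v (i t) := by
  have local_term (t : Fin n) : tensor (Function.update (fun _ => (1 : Matrix m m ℂ)) t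
      (Matrix.diagonal v)) = Matrix.diagonal fun i => v (i t) := by
    have factor (s : Fin n) : Function.update (fun _ => (1 : Matrix m m ℂ)) t
        (Matrix.diagonal v) s = Matrix.diagonal (Function.update (fun _ _ => 1) t v s) := by
      rcases eq_or_ne s t with rfl | hs
      · simp
      · simp [hs]
    rw [funext factor, tensor_diagonal]
    congr 1 with i
    rw [Fintype.prod_eq_single t fun s hs => by simp [hs], Function.update_self]
  simp only [totalHamiltonian, local_term]
  ext i j
  by_cases h : i = j
  · subst h; simp [Matrix.sum_apply]
  · simp [Matrix.sum_apply, h]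

variable [Fintype m]

theorem tensor_mul (σ τ : Fin n → Matrix m m ℂ) :
    tensor σ * tensor τ = tensor fun t => σ t * τ t := by
  ext i j
  simp only [tensor, Matrix.mul_apply, Matrix.of_apply, ← Finset.prod_mul_distrib,
    Fintype.prod_sum]

theorem trace_tensor (σ : Fin n → Matrix m m ℂ) : (tensor σ).trace = ∏ t, (σ t).trace := by
  simp [Matrix.trace, tensor, Fintype.prod_sum]

variable [DecidableEq m]

theorem tensor_mem_unitaryGroup {U : Fin n → Matrix m m ℂ}
    (hU : ∀ t, U t ∈ Matrix.unitaryGroup m ℂ) :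
    tensor U ∈ Matrix.unitaryGroup (Fin n → m) ℂ := by
  rw [Matrix.mem_unitaryGroup_iff, Matrix.star_eq_conjTranspose, tensor_conjTranspose, tensor_mul,
    ← tensor_one]
  exact congrArg tensor (funext fun t => Matrix.mem_unitaryGroup_iff.mp (hU t))

theorem isLinearMap_tensorPow (Λ : Matrix m m ℂ →ₗ[ℂ] Matrix m m ℂ) (n : ℕ) :
    IsLinearMap ℝ (tensorPow Λ n) where
  map_add ρ σ := by simp [tensorPow, add_smul, Finset.sum_add_distrib]
  map_smul c ρ := by simp only [tensorPow, Finset.smul_sum, Matrix.smul_apply, smul_assoc]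

end Tensor

section Energy

variable {m : Type*} [Fintype m]

theorem isLinearMap_energy (H : Matrix m m ℂ) : IsLinearMap ℝ fun ρ => energy ρ H where
  map_add ρ σ := by simp [energy, add_mul]
  map_smul c ρ := by simp [energy]

/-- The energy that the unitary `U` extracts from `ρ`; the ergotropy is its supremum over `U`. -/
noncomputable def extractedWork (U ρ H : Matrix m m ℂ) : ℝ :=
  energy ρ H - energy (U * ρ * Uᴴ) H

theorem isLinearMap_extractedWork (U H : Matrix m m ℂ) :
    IsLinearMap ℝ fun ρ => extractedWork U ρ H where
  map_add ρ σ := by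
    simp only [extractedWork, mul_add, add_mul, (isLinearMap_energy H).map_add]
    ring
  map_smul c ρ := by
    simp only [extractedWork, mul_smul_comm, smul_mul_assoc, (isLinearMap_energy H).map_smul,
      smul_sub]

variable [DecidableEq m]

theorem energy_diagonal (ρ : Matrix m m ℂ) (v : m → ℝ) :
    energy ρ (Matrix.diagonal fun i => (v i : ℂ)) = ∑ i, (ρ i i).re * v i := by
  simp [energy, Matrix.trace]

theorem energy_tensor {n : ℕ} {σ : Fin n → Matrix m m ℂ} (hσ : ∀ t, (σ t).trace = 1)
    (h : Matrix m m ℂ) :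
    energy (tensor σ) (totalHamiltonian h n) = ∑ t, energy (σ t) h := by
  simp only [energy, totalHamiltonian, Finset.mul_sum, Matrix.trace_sum, tensor_mul, trace_tensor,
    Complex.re_sum]
  refine Finset.sum_congr rfl fun t _ => congrArg Complex.re ?_
  rw [Fintype.prod_eq_single t fun s hs => by simp [hs, hσ], Function.update_self]

theorem ergotropy_le {ρ H : Matrix m m ℂ} {w : ℝ}
    (hw : ∀ U ∈ Matrix.unitaryGroup m ℂ, extractedWork U ρ H ≤ w) : ergotropy ρ H ≤ w :=
  csSup_le ⟨_, 1, one_mem _, rfl⟩ fun _ ⟨U, hU, h⟩ => h.trans_le (hw U hU)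

theorem ergotropy_eq_of_forall_le {ρ H U : Matrix m m ℂ} (hU : U ∈ Matrix.unitaryGroup m ℂ)
    (hmax : ∀ V ∈ Matrix.unitaryGroup m ℂ, extractedWork V ρ H ≤ extractedWork U ρ H) :
    ergotropy ρ H = extractedWork U ρ H :=
  IsGreatest.csSup_eq ⟨⟨U, hU, rfl⟩, fun _ ⟨V, hV, h⟩ => h.trans_le (hmax V hV)⟩

theorem extractedWork_tensor {n : ℕ} {U ρ : Matrix m m ℂ} (hU : U ∈ Matrix.unitaryGroup m ℂ)
    (hρ : ρ.trace = 1) (h : Matrix m m ℂ) :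
    extractedWork (tensor fun _ => U) (tensor fun _ => ρ) (totalHamiltonian h n) =
      n * extractedWork U ρ h := by
  have hconj : (U * ρ * Uᴴ).trace = 1 := by
    have hU' : Uᴴ * U = 1 := Matrix.mem_unitaryGroup_iff'.mp hU
    rw [Matrix.trace_mul_comm, ← mul_assoc, hU', one_mul, hρ]
  simp only [extractedWork, tensor_conjTranspose, tensor_mul, energy_tensor fun _ => hρ,
    energy_tensor fun _ => hconj, Finset.sum_const, Finset.card_univ, Fintype.card_fin,
    nsmul_eq_mul]
  ring

end Energy

section Entropy

variable {ι m : Type*} [Fintype ι] [Fintype m]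

theorem sum_prod_mul_sum [DecidableEq ι] {R : Type*} [CommSemiring R] (p g : ι → m → R)
    (hp : ∀ t, ∑ a, p t a = 1) :
    ∑ i : ι → m, (∏ t, p t (i t)) * ∑ s, g s (i s) = ∑ s, ∑ a, p s a * g s a := by
  have absorb (s : ι) (i : ι → m) : (∏ t, p t (i t)) * g s (i s) =
      ∏ t, Function.update p s (fun a => p s a * g s a) t (i t) := by
    rw [← Finset.mul_prod_erase _ _ (Finset.mem_univ s),
      ← Finset.mul_prod_erase _ _ (Finset.mem_univ s), Function.update_self, mul_right_comm]
    congr 1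
    exact Finset.prod_congr rfl fun t ht => by simp [Finset.ne_of_mem_erase ht]
  simp only [Finset.mul_sum, absorb]
  rw [Finset.sum_comm]
  refine Finset.sum_congr rfl fun s _ => ?_
  rw [← Fintype.prod_sum, Fintype.prod_eq_single s fun t ht => by simp [ht, hp],
    Function.update_self]

theorem sum_negMulLog_prod [DecidableEq ι] (p : ι → m → ℝ) (hp : ∀ t, ∑ a, p t a = 1) :
    ∑ i : ι → m, negMulLog (∏ t, p t (i t)) = ∑ t, ∑ a, negMulLog (p t a) := by
  have log_prod (i : ι → m) : negMulLog (∏ t, p t (i t)) =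
      (∏ t, p t (i t)) * ∑ t, -Real.log (p t (i t)) := by
    by_cases h : ∏ t, p t (i t) = 0
    · simp [h]
    · rw [negMulLog, Real.log_prod fun t _ => Finset.prod_ne_zero_iff.mp h t (Finset.mem_univ t),
        Finset.sum_neg_distrib, neg_mul_comm]
  rw [Finset.sum_congr rfl fun i _ => log_prod i,
    sum_prod_mul_sum p (fun t a => -Real.log (p t a)) hp]
  simp only [negMulLog, neg_mul_comm]

theorem negMulLog_le_mul_add_exp_neg_sub {a : ℝ} (ha : 0 ≤ a) (t : ℝ) :
    negMulLog a ≤ a * t + (Real.exp (-t) - a) := by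
  rcases ha.eq_or_lt with rfl | ha
  · simpa using (Real.exp_pos (-t)).le
  · have h := mul_le_mul_of_nonneg_left (Real.add_one_le_exp (-t - Real.log a)) ha.le
    rw [Real.exp_sub, Real.exp_log ha, mul_div_cancel₀ _ ha.ne'] at h
    rw [negMulLog]
    linarith

theorem sum_negMulLog_le_add_log_sum_exp {r : m → ℝ} (hr : ∀ i, 0 ≤ r i) (hr1 : ∑ i, r i = 1)
    (H : m → ℝ) :
    ∑ i, negMulLog (r i) ≤ ∑ i, r i * H i + Real.log (∑ i, Real.exp (-H i)) := by
  set Z := ∑ i, Real.exp (-H i)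
  have : Nonempty m := by
    by_contra h
    simp [not_nonempty_iff.mp h] at hr1
  have hZ : 0 < Z := Finset.sum_pos (fun i _ => Real.exp_pos _) Finset.univ_nonempty
  have gibbs_weights : ∑ i, Real.exp (-(H i + Real.log Z)) = 1 := by
    simp only [neg_add, Real.exp_add, ← Finset.sum_mul, Real.exp_neg (Real.log Z),
      Real.exp_log hZ]
    exact mul_inv_cancel₀ hZ.ne'
  calc ∑ i, negMulLog (r i)
      ≤ ∑ i, (r i * (H i + Real.log Z) + (Real.exp (-(H i + Real.log Z)) - r i)) :=
        Finset.sum_le_sum fun i _ => negMulLog_le_mul_add_exp_neg_sub (hr i) _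
    _ = ∑ i, r i * H i + Real.log Z := by
        simp only [mul_add, Finset.sum_add_distrib, Finset.sum_sub_distrib, ← Finset.sum_mul,
          gibbs_weights, hr1]
        ring

theorem sum_negMulLog_le_sum_negMulLog_mulVec [DecidableEq m] {P : Matrix m m ℝ}
    (hP : P ∈ doublyStochastic ℝ m) {d : m → ℝ} (hd : ∀ j, 0 ≤ d j) :
    ∑ j, negMulLog (d j) ≤ ∑ i, negMulLog ((P *ᵥ d) i) := by
  obtain ⟨hP0, hrow, hcol⟩ := mem_doublyStochastic_iff_sum.mp hP
  calc ∑ j, negMulLog (d j) = ∑ i, ∑ j, P i j * negMulLog (d j) := by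
        rw [Finset.sum_comm]
        simp only [← Finset.sum_mul, hcol, one_mul]
    _ ≤ ∑ i, negMulLog ((P *ᵥ d) i) := Finset.sum_le_sum fun i _ =>
        Real.concaveOn_negMulLog.le_map_sum (fun j _ => hP0 i j) (hrow i) fun j _ => hd j

end Entropy

section Spectrum

variable {m : Type*} [Fintype m] [DecidableEq m] {ρ : Matrix m m ℂ} {d : m → ℝ}

/-- `ρ` is unitarily diagonalizable with eigenvalues `d`, listed with multiplicity in some order. -/
def HasSpectrum (ρ : Matrix m m ℂ) (d : m → ℝ) : Prop :=
  ∃ U ∈ Matrix.unitaryGroup m ℂ, ρ = U * Matrix.diagonal (fun j => (d j : ℂ)) * Uᴴ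

theorem hasSpectrum_eigenvalues (hρ : ρ.IsHermitian) : HasSpectrum ρ hρ.eigenvalues :=
  ⟨hρ.eigenvectorUnitary, hρ.eigenvectorUnitary.2,
    hρ.spectral_theorem.trans (Unitary.conjStarAlgAut_apply _ _)⟩

theorem normSq_mem_doublyStochastic {U : Matrix m m ℂ} (hU : U ∈ Matrix.unitaryGroup m ℂ) :
    U.map Complex.normSq ∈ doublyStochastic ℝ m := by
  refine mem_doublyStochastic_iff_sum.mpr ⟨fun i j => Complex.normSq_nonneg _, fun i => ?_,
    fun j => ?_⟩
  · have h := congrFun₂ (Matrix.mem_unitaryGroup_iff.mp hU) i i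
    simp only [Matrix.mul_apply, Matrix.star_apply, RCLike.star_def, Complex.mul_conj,
      Matrix.one_apply_eq] at h
    exact_mod_cast h
  · have h := congrFun₂ (Matrix.mem_unitaryGroup_iff'.mp hU) j j
    simp only [Matrix.mul_apply, Matrix.star_apply, RCLike.star_def, mul_comm (starRingEnd ℂ _),
      Complex.mul_conj, Matrix.one_apply_eq] at h
    exact_mod_cast h

namespace HasSpectrum

theorem conj (h : HasSpectrum ρ d) {V : Matrix m m ℂ} (hV : V ∈ Matrix.unitaryGroup m ℂ) :
    HasSpectrum (V * ρ * Vᴴ) d := by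
  obtain ⟨U, hU, rfl⟩ := h
  exact ⟨V * U, mul_mem hV hU, by simp only [Matrix.conjTranspose_mul, mul_assoc]⟩

theorem comp_equiv (h : HasSpectrum ρ d) (e : m ≃ m) : HasSpectrum ρ (d ∘ e) := by
  obtain ⟨U, hU, rfl⟩ := h
  refine ⟨U.submatrix id e, ?_, ?_⟩
  · rw [Matrix.mem_unitaryGroup_iff, Matrix.star_eq_conjTranspose, Matrix.conjTranspose_submatrix,
      Matrix.submatrix_mul_equiv, Matrix.submatrix_id_id]
    exact Matrix.mem_unitaryGroup_iff.mp hU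
  · have hdiag : Matrix.diagonal (fun j => ((d ∘ e) j : ℂ)) =
        (Matrix.diagonal fun j => (d j : ℂ)).submatrix e e :=
      (Matrix.submatrix_diagonal_equiv (fun j => (d j : ℂ)) e).symm
    simp only [hdiag, Matrix.conjTranspose_submatrix, Matrix.submatrix_mul_equiv,
      Matrix.submatrix_id_id]

theorem tensor {n : ℕ} {σ : Fin n → Matrix m m ℂ} {d : Fin n → m → ℝ}
    (h : ∀ t, HasSpectrum (σ t) (d t)) :
    HasSpectrum (tensor σ) fun i => ∏ t, d t (i t) := by
  choose U hU hσ using h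
  refine ⟨QBattery.tensor U, tensor_mem_unitaryGroup hU, ?_⟩
  simp only [Complex.ofReal_prod]
  rw [← tensor_diagonal fun t a => (d t a : ℂ), tensor_conjTranspose, tensor_mul, tensor_mul,
    ← funext hσ]

theorem exists_conj_eq_diagonal (h : HasSpectrum ρ d) :
    ∃ V ∈ Matrix.unitaryGroup m ℂ, V * ρ * Vᴴ = Matrix.diagonal fun j => (d j : ℂ) := by
  obtain ⟨U, hU, rfl⟩ := h
  have hU' : Uᴴ * U = 1 := Matrix.mem_unitaryGroup_iff'.mp hU
  refine ⟨Uᴴ, Unitary.star_mem hU, ?_⟩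
  rw [Matrix.conjTranspose_conjTranspose, ← mul_assoc, ← mul_assoc, hU', one_mul, mul_assoc, hU',
    mul_one]

theorem posSemidef (h : HasSpectrum ρ d) (hd : ∀ j, 0 ≤ d j) : ρ.PosSemidef := by
  obtain ⟨U, -, rfl⟩ := h
  exact (Matrix.PosSemidef.diagonal fun j => Complex.zero_le_real.mpr
    (hd j)).mul_mul_conjTranspose_same U

theorem exists_doublyStochastic (h : HasSpectrum ρ d) :
    ∃ P ∈ doublyStochastic ℝ m, ∀ i, (ρ i i).re = (P *ᵥ d) i := by
  obtain ⟨U, hU, rfl⟩ := h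
  refine ⟨_, normSq_mem_doublyStochastic hU, fun i => ?_⟩
  rw [Matrix.mul_apply, Complex.re_sum]
  refine Finset.sum_congr rfl fun j _ => ?_
  rw [Matrix.mul_diagonal, Matrix.conjTranspose_apply, RCLike.star_def, mul_right_comm,
    Complex.mul_conj, ← Complex.ofReal_mul, Complex.ofReal_re]
  rfl

theorem le_diag (h : HasSpectrum ρ d) {c : ℝ} (hc : ∀ j, c ≤ d j) (i : m) : c ≤ (ρ i i).re := by
  obtain ⟨P, hP, hdiag⟩ := h.exists_doublyStochastic
  obtain ⟨hP0, hrow, -⟩ := mem_doublyStochastic_iff_sum.mp hP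
  calc c = ∑ j, P i j * c := by rw [← Finset.sum_mul, hrow, one_mul]
    _ ≤ ∑ j, P i j * d j :=
        Finset.sum_le_sum fun j _ => mul_le_mul_of_nonneg_left (hc j) (hP0 i j)
    _ = (ρ i i).re := (hdiag i).symm

theorem sum_negMulLog_le_energy_add_log (h : HasSpectrum ρ d) (hd : ∀ j, 0 ≤ d j)
    (hd1 : ∑ j, d j = 1) (v : m → ℝ) :
    ∑ j, negMulLog (d j) ≤
      energy ρ (Matrix.diagonal fun i => (v i : ℂ)) + Real.log (∑ i, Real.exp (-v i)) := by
  obtain ⟨P, hP, hdiag⟩ := h.exists_doublyStochastic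
  simp only [energy_diagonal, hdiag]
  refine (sum_negMulLog_le_sum_negMulLog_mulVec hP hd).trans
    (sum_negMulLog_le_add_log_sum_exp (fun i => ?_) ?_ v)
  · exact hdiag i ▸ h.le_diag hd i
  · rw [sum_mulVec_of_mem_doublyStochastic hP, hd1]

theorem sum_negMulLog_le_energy_totalHamiltonian {n : ℕ} {d : (Fin n → m) → ℝ}
    {ρ : Matrix (Fin n → m) (Fin n → m) ℂ} (h : HasSpectrum ρ d) (hd : ∀ i, 0 ≤ d i)
    (hd1 : ∑ i, d i = 1) (β : ℝ) (v : m → ℝ) :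
    ∑ i, negMulLog (d i) ≤
      β * energy ρ (totalHamiltonian (Matrix.diagonal fun a => (v a : ℂ)) n) +
        n * Real.log (∑ a, Real.exp (-(β * v a))) := by
  refine (h.sum_negMulLog_le_energy_add_log hd hd1 fun i => ∑ t, β * v (i t)).trans_eq ?_
  congr 1
  · simp only [totalHamiltonian_diagonal, ← Complex.ofReal_sum, energy_diagonal, ← Finset.mul_sum]
    simp only [Finset.mul_sum, mul_left_comm]
  · rw [← Real.log_pow, Fintype.sum_pow]
    simp only [← Real.exp_sum, Finset.sum_neg_distrib]

end HasSpectrum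

end Spectrum

section Convexity

theorem convexOn_comp_of_mapsTo {E : Type*} [AddCommMonoid E] [Module ℝ E] {s : Set E}
    {t : Set ℝ} {g : ℝ → ℝ} {f : E → ℝ} (hg : ConvexOn ℝ t g) (hmono : MonotoneOn g t)
    (hf : ConvexOn ℝ s f) (hmaps : Set.MapsTo f s t) : ConvexOn ℝ s (g ∘ f) :=
  ⟨hf.1, fun _ hx _ hy _ _ ha hb hab =>
    (hmono (hmaps (hf.1 hx hy ha hb hab)) (hg.1 (hmaps hx) (hmaps hy) ha hb hab)
      (hf.2 hx hy ha hb hab)).trans (hg.2 (hmaps hx) (hmaps hy) ha hb hab)⟩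

theorem mul_map_average_le_sum {s : Set ℝ} {f : ℝ → ℝ} (hf : ConvexOn ℝ s f) {n : ℕ} (hn : 0 < n)
    {x : Fin n → ℝ} (hx : ∀ t, x t ∈ s) : n * f ((∑ t, x t) / n) ≤ ∑ t, f (x t) := by
  have hn' : (0 : ℝ) < n := Nat.cast_pos.mpr hn
  have jensen := hf.map_sum_le (t := Finset.univ) (w := fun _ : Fin n => (n : ℝ)⁻¹)
    (fun _ _ => by positivity) (by simp [hn'.ne']) fun t _ => hx t
  simp only [smul_eq_mul, ← Finset.mul_sum] at jensen
  rw [div_eq_inv_mul]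
  exact (le_inv_mul_iff₀ hn').mp jensen

/-- The smaller of the two eigenvalues with sum `1` and product `x ^ 2 / 4`, as a function of `x`:
the energy left in an optimally discharged qubit of concurrence `x`. -/
noncomputable def minEig (x : ℝ) : ℝ := (1 - √(1 - x ^ 2)) / 2

theorem minEig_mem_Icc (x : ℝ) : minEig x ∈ Set.Icc 0 2⁻¹ := by
  have h1 : √(1 - x ^ 2) ≤ 1 := Real.sqrt_le_one.mpr (by linarith [sq_nonneg x])
  have h0 := Real.sqrt_nonneg (1 - x ^ 2)
  constructor <;> unfold minEig <;> linarith

theorem monotoneOn_minEig : MonotoneOn minEig (Set.Ici 0) := fun x hx y _ hxy => by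
  have h : √(1 - y ^ 2) ≤ √(1 - x ^ 2) :=
    Real.sqrt_le_sqrt (sub_le_sub_left (pow_le_pow_left₀ hx hxy 2) 1)
  unfold minEig
  linarith

@[fun_prop]
theorem continuous_minEig : Continuous minEig := by
  unfold minEig
  fun_prop

theorem minEig_two_mul_sqrt {p : ℝ} (hp : p ∈ Set.Icc 0 2⁻¹) : minEig (2 * √(p * (1 - p))) = p := by
  have hsq : 1 - (2 * √(p * (1 - p))) ^ 2 = (1 - 2 * p) ^ 2 := by
    rw [mul_pow, Real.sq_sqrt (mul_nonneg hp.1 (by linarith [hp.2]))]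
    ring
  rw [minEig, hsq, Real.sqrt_sq (by linarith [hp.2])]
  ring

theorem monotoneOn_binEntropy_minEig : MonotoneOn (binEntropy ∘ minEig) (Set.Ici 0) :=
  Real.binEntropy_strictMonoOn.monotoneOn.comp monotoneOn_minEig fun x _ => minEig_mem_Icc x

section Derivatives

variable {x : ℝ}

theorem sqrt_one_sub_sq_mem_Ioo (hx : x ∈ Set.Ioo (0 : ℝ) 1) : √(1 - x ^ 2) ∈ Set.Ioo (0 : ℝ) 1 :=
  ⟨Real.sqrt_pos.mpr (by nlinarith [hx.1, hx.2]),
    (Real.sqrt_lt' one_pos).mpr (by nlinarith [hx.1, hx.2])⟩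

theorem sq_sqrt_one_sub_sq (hx : x ∈ Set.Ioo (0 : ℝ) 1) : √(1 - x ^ 2) ^ 2 = 1 - x ^ 2 :=
  Real.sq_sqrt (by nlinarith [hx.1, hx.2])

theorem hasDerivAt_sqrt_one_sub_sq (hx : x ∈ Set.Ioo (0 : ℝ) 1) :
    HasDerivAt (fun x : ℝ => √(1 - x ^ 2)) (-(x / √(1 - x ^ 2))) x := by
  have hpos := (Real.sqrt_pos.mp (sqrt_one_sub_sq_mem_Ioo hx).1).ne'
  refine (((hasDerivAt_pow 2 x).const_sub 1).sqrt hpos).congr_deriv ?_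
  simp only [Nat.cast_ofNat, Nat.add_one_sub_one, pow_one]
  ring

theorem hasDerivAt_minEig (hx : x ∈ Set.Ioo (0 : ℝ) 1) :
    HasDerivAt minEig (x / √(1 - x ^ 2) / 2) x :=
  (((hasDerivAt_sqrt_one_sub_sq hx).const_sub 1).div_const 2).congr_deriv (by simp)

theorem hasDerivAt_div_sqrt_one_sub_sq (hx : x ∈ Set.Ioo (0 : ℝ) 1) :
    HasDerivAt (fun x : ℝ => x / √(1 - x ^ 2)) (1 / √(1 - x ^ 2) ^ 3) x := by
  have hs := (sqrt_one_sub_sq_mem_Ioo hx).1.ne'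
  refine ((hasDerivAt_id x).div (hasDerivAt_sqrt_one_sub_sq hx) hs).congr_deriv ?_
  simp only [id]
  field_simp
  linear_combination sq_sqrt_one_sub_sq hx

theorem hasDerivAt_binEntropy_minEig (hx : x ∈ Set.Ioo (0 : ℝ) 1) :
    HasDerivAt (binEntropy ∘ minEig) (x / √(1 - x ^ 2) / 2 *
      (Real.log (1 + √(1 - x ^ 2)) - Real.log (1 - √(1 - x ^ 2)))) x := by
  obtain ⟨hs0, hs1⟩ := sqrt_one_sub_sq_mem_Ioo hx
  have h0 : minEig x ≠ 0 := by unfold minEig; linarith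
  have h1 : minEig x ≠ 1 := by unfold minEig; linarith
  refine ((Real.hasDerivAt_binEntropy h0 h1).comp x (hasDerivAt_minEig hx)).congr_deriv ?_
  have hsub : 1 - minEig x = (1 + √(1 - x ^ 2)) / 2 := by unfold minEig; ring
  rw [hsub, minEig, Real.log_div (by linarith) two_ne_zero, Real.log_div (by linarith) two_ne_zero]
  ring

theorem hasDerivAt_log_one_add_sub_log_one_sub (hx : x ∈ Set.Ioo (0 : ℝ) 1) :
    HasDerivAt (fun x : ℝ => Real.log (1 + √(1 - x ^ 2)) - Real.log (1 - √(1 - x ^ 2)))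
      (-2 / (x * √(1 - x ^ 2))) x := by
  have hx0 := hx.1.ne'
  have hsq := sq_sqrt_one_sub_sq hx
  have hd := hasDerivAt_sqrt_one_sub_sq hx
  obtain ⟨hs0, hs1⟩ := sqrt_one_sub_sq_mem_Ioo hx
  have hs := hs0.ne'
  have hadd : 1 + √(1 - x ^ 2) ≠ 0 := by linarith
  have hsub : 1 - √(1 - x ^ 2) ≠ 0 := by linarith
  refine (((hd.const_add 1).log hadd).sub ((hd.const_sub 1).log hsub)).congr_deriv ?_
  field_simp
  linear_combination -2 * hsq

theorem hasDerivAt_deriv_binEntropy_minEig (hx : x ∈ Set.Ioo (0 : ℝ) 1) :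
    HasDerivAt (fun x : ℝ => x / √(1 - x ^ 2) / 2 *
        (Real.log (1 + √(1 - x ^ 2)) - Real.log (1 - √(1 - x ^ 2))))
      ((Real.log (1 + √(1 - x ^ 2)) - Real.log (1 - √(1 - x ^ 2)) - 2 * √(1 - x ^ 2)) /
        √(1 - x ^ 2) ^ 3 / 2) x := by
  have hx0 := hx.1.ne'
  have hs := (sqrt_one_sub_sq_mem_Ioo hx).1.ne'
  refine (((hasDerivAt_div_sqrt_one_sub_sq hx).div_const 2).mul
    (hasDerivAt_log_one_add_sub_log_one_sub hx)).congr_deriv ?_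
  field_simp
  ring

end Derivatives

theorem two_mul_le_log_one_add_sub_log_one_sub {s : ℝ} (h0 : 0 ≤ s) (h1 : s < 1) :
    2 * s ≤ Real.log (1 + s) - Real.log (1 - s) := by
  have series := Real.hasSum_log_sub_log_of_abs_lt_one (abs_lt.mpr ⟨by linarith, h1⟩)
  simpa using sum_le_hasSum {0} (fun k _ => by positivity) series

theorem convexOn_minEig : ConvexOn ℝ (Set.Icc 0 1) minEig := by
  refine convexOn_of_hasDerivWithinAt2_nonneg (convex_Icc 0 1) continuous_minEig.continuousOn
    (f' := fun x => x / √(1 - x ^ 2) / 2) (f'' := fun x => 1 / √(1 - x ^ 2) ^ 3 / 2)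
    ?_ ?_ fun x _ => by positivity
  all_goals rw [interior_Icc]; intro x hx
  · exact (hasDerivAt_minEig hx).hasDerivWithinAt
  · exact ((hasDerivAt_div_sqrt_one_sub_sq hx).div_const 2).hasDerivWithinAt

theorem convexOn_binEntropy_minEig : ConvexOn ℝ (Set.Icc 0 1) (binEntropy ∘ minEig) := by
  refine convexOn_of_hasDerivWithinAt2_nonneg (convex_Icc 0 1)
    (Real.binEntropy_continuous.comp continuous_minEig).continuousOn
    (fun x hx => (hasDerivAt_binEntropy_minEig ?_).hasDerivWithinAt)
    (fun x hx => (hasDerivAt_deriv_binEntropy_minEig ?_).hasDerivWithinAt) fun x hx => ?_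
  all_goals rw [interior_Icc] at hx
  · exact hx
  · exact hx
  · obtain ⟨hs0, hs1⟩ := sqrt_one_sub_sq_mem_Ioo hx
    have hlog := two_mul_le_log_one_add_sub_log_one_sub hs0.le hs1
    exact div_nonneg (div_nonneg (sub_nonneg.mpr hlog) (pow_pos hs0 3).le) two_pos.le

end Convexity

section Qubit

variable {ρ : Matrix (Fin 2) (Fin 2) ℂ}

theorem qubitHamiltonian_eq_diagonal :
    qubitHamiltonian = Matrix.diagonal fun a => ((![0, 1] a : ℝ) : ℂ) := by
  ext i j
  fin_cases i <;> fin_cases j <;> simp [qubitHamiltonian]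

theorem energy_qubitHamiltonian (ρ : Matrix (Fin 2) (Fin 2) ℂ) :
    energy ρ qubitHamiltonian = (ρ 1 1).re := by
  rw [qubitHamiltonian_eq_diagonal, energy_diagonal]
  simp

theorem IsDensity.energy_mem_Icc (hρ : IsDensity ρ) :
    energy ρ qubitHamiltonian ∈ Set.Icc (0 : ℝ) 1 := by
  rw [energy_qubitHamiltonian]
  have htr := congrArg Complex.re hρ.2
  rw [Matrix.trace_fin_two, Complex.add_re, Complex.one_re] at htr
  have h0 : 0 ≤ (ρ 0 0).re := (Complex.le_def.mp hρ.1.diag_nonneg).1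
  have h1 : 0 ≤ (ρ 1 1).re := (Complex.le_def.mp hρ.1.diag_nonneg).1
  exact ⟨h1, by linarith⟩

/-- The level populations of a qubit of energy `p`. -/
def populations (p : ℝ) : Fin 2 → ℝ := ![1 - p, p]

theorem eq_populations {d : Fin 2 → ℝ} (hd : d 0 + d 1 = 1) : d = populations (d 1) := by
  ext a
  fin_cases a
  · exact eq_sub_of_add_eq hd
  · rfl

theorem sum_populations (p : ℝ) : ∑ a, populations p a = 1 := by simp [populations]

theorem sum_negMulLog_populations (p : ℝ) : ∑ a, negMulLog (populations p a) = binEntropy p := by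
  simp [populations, Real.binEntropy_eq_negMulLog_add_negMulLog_one_sub, add_comm]

theorem le_populations {p : ℝ} (hp : p ≤ 2⁻¹) (a : Fin 2) : p ≤ populations p a := by
  fin_cases a
  · change p ≤ 1 - p
    linarith
  · exact le_rfl

theorem exists_hasSpectrum_populations (hρ : ρ.IsHermitian) (htr : ρ.trace = 1) :
    ∃ p ≤ 2⁻¹, HasSpectrum ρ (populations p) ∧ ρ.det.re = p * (1 - p) := by
  set d := hρ.eigenvalues
  have hsum : d 0 + d 1 = 1 := by
    have h := congrArg Complex.re (hρ.trace_eq_sum_eigenvalues.symm.trans htr)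
    rw [Fin.sum_univ_two] at h
    exact h
  have hdet : ρ.det.re = d 0 * d 1 := by
    have h := congrArg Complex.re hρ.det_eq_prod_eigenvalues
    rw [Fin.prod_univ_two] at h
    exact h.trans (by simp [d])
  rcases le_total (d 1) (d 0) with hle | hle
  · exact ⟨d 1, by linarith, eq_populations hsum ▸ hasSpectrum_eigenvalues hρ, by
      rw [hdet, ← hsum]; ring⟩
  · have hswap : d ∘ Equiv.swap 0 1 = populations (d 0) :=
      eq_populations ((add_comm _ _).trans hsum)
    exact ⟨d 0, by linarith, hswap ▸ (hasSpectrum_eigenvalues hρ).comp_equiv _, by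
      rw [hdet, ← hsum]; ring⟩

theorem isDensity_of_det_nonneg (hρ : ρ.IsHermitian) (htr : ρ.trace = 1) (hdet : 0 ≤ ρ.det.re) :
    IsDensity ρ := by
  obtain ⟨p, hp, hspec, hdet_eq⟩ := exists_hasSpectrum_populations hρ htr
  have hp0 : 0 ≤ p := by nlinarith
  exact ⟨hspec.posSemidef fun a => hp0.trans (le_populations hp a), htr⟩

/-- The concurrence of the purifications of the qubit state `ρ`, which determines the spectrum of
`ρ`. -/
noncomputable def concurrence (ρ : Matrix (Fin 2) (Fin 2) ℂ) : ℝ := 2 * √ρ.det.re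

theorem concurrence_nonneg (ρ : Matrix (Fin 2) (Fin 2) ℂ) : 0 ≤ concurrence ρ := by
  unfold concurrence
  positivity

namespace IsDensity

theorem det_re_nonneg (hρ : IsDensity ρ) : 0 ≤ ρ.det.re := (Complex.le_def.mp hρ.1.det_nonneg).1

theorem exists_hasSpectrum (hρ : IsDensity ρ) :
    ∃ p ∈ Set.Icc 0 2⁻¹, HasSpectrum ρ (populations p) ∧ ρ.det.re = p * (1 - p) := by
  obtain ⟨p, hp, hspec, hdet⟩ := exists_hasSpectrum_populations hρ.1.isHermitian hρ.2
  have hp0 : 0 ≤ p := by nlinarith [hρ.det_re_nonneg]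
  exact ⟨p, ⟨hp0, hp⟩, hspec, hdet⟩

theorem concurrence_le_one (hρ : IsDensity ρ) : concurrence ρ ≤ 1 := by
  obtain ⟨p, -, -, hdet⟩ := hρ.exists_hasSpectrum
  have hsqrt : √ρ.det.re ≤ 2⁻¹ := by
    rw [Real.sqrt_le_left (by norm_num), hdet]
    linarith [sq_nonneg (p - 2⁻¹)]
  unfold concurrence
  linarith

theorem hasSpectrum (hρ : IsDensity ρ) :
    HasSpectrum ρ (populations (minEig (concurrence ρ))) := by
  obtain ⟨p, hp, hspec, hdet⟩ := hρ.exists_hasSpectrum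
  rwa [concurrence, hdet, minEig_two_mul_sqrt hp]

theorem extractedWork_le (hρ : IsDensity ρ) {U : Matrix (Fin 2) (Fin 2) ℂ}
    (hU : U ∈ Matrix.unitaryGroup (Fin 2) ℂ) :
    extractedWork U ρ qubitHamiltonian ≤
      energy ρ qubitHamiltonian - minEig (concurrence ρ) := by
  rw [extractedWork, energy_qubitHamiltonian (U * ρ * Uᴴ)]
  exact sub_le_sub_left
    ((hρ.hasSpectrum.conj hU).le_diag (le_populations (minEig_mem_Icc _).2) 1) _

theorem exists_extractedWork_eq (hρ : IsDensity ρ) : ∃ U ∈ Matrix.unitaryGroup (Fin 2) ℂ,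
    extractedWork U ρ qubitHamiltonian =
      energy ρ qubitHamiltonian - minEig (concurrence ρ) := by
  obtain ⟨U, hU, hdiag⟩ := hρ.hasSpectrum.exists_conj_eq_diagonal
  refine ⟨U, hU, ?_⟩
  rw [extractedWork, hdiag, energy_qubitHamiltonian (Matrix.diagonal _), Matrix.diagonal_apply_eq,
    Complex.ofReal_re]
  rfl

theorem ergotropy_qubitHamiltonian (hρ : IsDensity ρ) :
    ergotropy ρ qubitHamiltonian = energy ρ qubitHamiltonian - minEig (concurrence ρ) := by
  obtain ⟨U, hU, hwork⟩ := hρ.exists_extractedWork_eq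
  rw [← hwork]
  exact ergotropy_eq_of_forall_le hU fun V hV => hwork ▸ hρ.extractedWork_le hV

end IsDensity

theorem binEntropy_eq_mul_add_log_sum_exp {μ : ℝ} (h0 : 0 < μ) (h1 : μ < 1) :
    binEntropy μ = (Real.log (1 - μ) - Real.log μ) * μ + Real.log (∑ a : Fin 2,
      Real.exp (-((Real.log (1 - μ) - Real.log μ) * (![0, 1] : Fin 2 → ℝ) a))) := by
  have h1' : 0 < 1 - μ := sub_pos.mpr h1
  have partition : ∑ a : Fin 2, Real.exp (-((Real.log (1 - μ) - Real.log μ) *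
      (![0, 1] : Fin 2 → ℝ) a)) = (1 - μ)⁻¹ := by
    simp only [Fin.sum_univ_two, Matrix.cons_val_zero, Matrix.cons_val_one, mul_zero, mul_one,
      neg_zero, Real.exp_zero, neg_sub, Real.exp_sub, Real.exp_log h0, Real.exp_log h1']
    field_simp
    ring
  rw [partition, Real.log_inv, Real.binEntropy_eq_negMulLog_add_negMulLog_one_sub, negMulLog,
    negMulLog]
  ring

namespace HasSpectrum

variable {n : ℕ} {ρ : Matrix (Fin n → Fin 2) (Fin n → Fin 2) ℂ} {d : (Fin n → Fin 2) → ℝ}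

theorem energy_totalHamiltonian_nonneg (h : HasSpectrum ρ d) (hd : ∀ i, 0 ≤ d i) :
    0 ≤ energy ρ (totalHamiltonian qubitHamiltonian n) := by
  simp only [qubitHamiltonian_eq_diagonal, totalHamiltonian_diagonal, ← Complex.ofReal_sum,
    energy_diagonal]
  have level_nonneg (a : Fin 2) : (0 : ℝ) ≤ ![0, 1] a := by fin_cases a <;> simp
  exact Finset.sum_nonneg fun i _ => mul_nonneg (h.le_diag hd i)
    (Finset.sum_nonneg fun t _ => level_nonneg (i t))

theorem mul_le_energy_of_mem_Ioo (h : HasSpectrum ρ d) (hd : ∀ i, 0 ≤ d i) (hd1 : ∑ i, d i = 1)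
    {μ : ℝ} (hμ : μ ∈ Set.Ioo 0 2⁻¹) (hS : n * binEntropy μ ≤ ∑ i, negMulLog (d i)) :
    n * μ ≤ energy ρ (totalHamiltonian qubitHamiltonian n) := by
  obtain ⟨h0, h1⟩ := hμ
  -- the inverse temperature at which the thermal state of a cell has energy `μ`
  set β := Real.log (1 - μ) - Real.log μ with hβ
  have hβ0 : 0 < β := sub_pos.mpr (Real.log_lt_log h0 (by linarith))
  have gibbs := hS.trans (h.sum_negMulLog_le_energy_totalHamiltonian hd hd1 β ![0, 1])
  rw [binEntropy_eq_mul_add_log_sum_exp h0 (by linarith), ← hβ, mul_add, add_le_add_iff_right,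
    ← qubitHamiltonian_eq_diagonal, mul_left_comm] at gibbs
  exact le_of_mul_le_mul_left gibbs hβ0

theorem mul_le_energy_totalHamiltonian (h : HasSpectrum ρ d) (hd : ∀ i, 0 ≤ d i)
    (hd1 : ∑ i, d i = 1) {μ : ℝ} (hμ : μ ∈ Set.Icc 0 2⁻¹)
    (hS : n * binEntropy μ ≤ ∑ i, negMulLog (d i)) :
    n * μ ≤ energy ρ (totalHamiltonian qubitHamiltonian n) := by
  obtain ⟨h0, h1⟩ := hμ
  rcases h0.eq_or_lt with rfl | h0
  · simpa using h.energy_totalHamiltonian_nonneg hd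
  have hlim : Tendsto (fun ν : ℝ => n * ν) (𝓝[<] μ) (𝓝 (n * μ)) :=
    (continuous_const_mul (n : ℝ)).continuousWithinAt
  refine le_of_tendsto hlim ?_
  filter_upwards [Ioo_mem_nhdsLT h0] with ν hν
  refine h.mul_le_energy_of_mem_Ioo hd hd1 ⟨hν.1, hν.2.trans_le h1⟩ (le_trans ?_ hS)
  exact mul_le_mul_of_nonneg_left (Real.binEntropy_strictMonoOn
    ⟨hν.1.le, hν.2.le.trans h1⟩ ⟨h0.le, h1⟩ hν.2).le n.cast_nonneg

end HasSpectrum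

theorem mul_le_energy_conj_tensor {n : ℕ} {τ : Fin n → Matrix (Fin 2) (Fin 2) ℂ}
    (hτ : ∀ t, IsDensity (τ t)) {μ : ℝ} (hμ : μ ∈ Set.Icc 0 2⁻¹)
    (hS : n * binEntropy μ ≤ ∑ t, binEntropy (minEig (concurrence (τ t))))
    {U : Matrix (Fin n → Fin 2) (Fin n → Fin 2) ℂ} (hU : U ∈ Matrix.unitaryGroup _ ℂ) :
    n * μ ≤ energy (U * tensor τ * Uᴴ) (totalHamiltonian qubitHamiltonian n) := by
  set p : Fin n → Fin 2 → ℝ := fun t => populations (minEig (concurrence (τ t)))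
  have hp0 (t : Fin n) (a : Fin 2) : 0 ≤ p t a :=
    (minEig_mem_Icc _).1.trans (le_populations (minEig_mem_Icc _).2 a)
  have hp1 (t : Fin n) : ∑ a, p t a = 1 := sum_populations _
  have hspec : HasSpectrum (U * tensor τ * Uᴴ) fun i => ∏ t, p t (i t) :=
    (HasSpectrum.tensor fun t => (hτ t).hasSpectrum).conj hU
  refine hspec.mul_le_energy_totalHamiltonian
    (fun i => Finset.prod_nonneg fun t _ => hp0 t (i t)) ?_ hμ ?_
  · simp only [← Fintype.prod_sum, hp1, Finset.prod_const_one]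
  · rw [sum_negMulLog_prod p hp1]
    simpa only [p, sum_negMulLog_populations] using hS

end Qubit

section Channel

variable {Λ : Matrix (Fin 2) (Fin 2) ℂ →ₗ[ℂ] Matrix (Fin 2) (Fin 2) ℂ} {a b : ℝ} {C : ℝ → ℝ}

/-- The features of a damping channel `Λ` that determine its separable-input capacitance: on
states, `Λ` acts on the energy as `ε ↦ a + b * ε`, and the least output concurrence `C ε` among the
states of energy `ε` is attained and convex in `ε`. -/
structure HasConvexProfile (Λ : Matrix (Fin 2) (Fin 2) ℂ →ₗ[ℂ] Matrix (Fin 2) (Fin 2) ℂ)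
    (a b : ℝ) (C : ℝ → ℝ) : Prop where
  isDensity_map : ∀ {ρ}, IsDensity ρ → IsDensity (Λ ρ)
  energy_map : ∀ {ρ}, IsDensity ρ →
    energy (Λ ρ) qubitHamiltonian = a + b * energy ρ qubitHamiltonian
  le_concurrence_map : ∀ {ρ}, IsDensity ρ → C (energy ρ qubitHamiltonian) ≤ concurrence (Λ ρ)
  exists_concurrence_map_eq : ∀ {ε}, ε ∈ Set.Icc (0 : ℝ) 1 →
    ∃ ρ, IsDensity ρ ∧ energy ρ qubitHamiltonian = ε ∧ concurrence (Λ ρ) = C ε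
  convexOn : ConvexOn ℝ (Set.Icc 0 1) C
  continuousOn : ContinuousOn C (Set.Icc 0 1)

/-- The largest output ergotropy of one use, at input energy exactly `ε`, of a channel with profile
`a`, `b`, `C`. -/
noncomputable def outputErgotropy (a b : ℝ) (C : ℝ → ℝ) (ε : ℝ) : ℝ := a + b * ε - minEig (C ε)

namespace HasConvexProfile

theorem mapsTo (hΛ : HasConvexProfile Λ a b C) : Set.MapsTo C (Set.Icc 0 1) (Set.Icc 0 1) :=
  fun ε hε => by
    obtain ⟨ρ, hρ, -, hC⟩ := hΛ.exists_concurrence_map_eq hε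
    exact hC ▸ ⟨concurrence_nonneg _, (hΛ.isDensity_map hρ).concurrence_le_one⟩

theorem concaveOn_outputErgotropy (hΛ : HasConvexProfile Λ a b C) :
    ConcaveOn ℝ (Set.Icc 0 1) (outputErgotropy a b C) := by
  have affine : ConcaveOn ℝ (Set.Icc 0 1) fun ε : ℝ => a + b * ε :=
    (concaveOn_const a (convex_Icc 0 1)).add ((b • LinearMap.id).concaveOn (convex_Icc 0 1))
  exact affine.sub (convexOn_comp_of_mapsTo convexOn_minEig
    (monotoneOn_minEig.mono Set.Icc_subset_Ici_self) hΛ.convexOn hΛ.mapsTo)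

theorem continuousOn_outputErgotropy (hΛ : HasConvexProfile Λ a b C) :
    ContinuousOn (outputErgotropy a b C) (Set.Icc 0 1) := by
  have := hΛ.continuousOn
  unfold outputErgotropy
  fun_prop

theorem ergotropy_map_le (hΛ : HasConvexProfile Λ a b C) {ρ : Matrix (Fin 2) (Fin 2) ℂ}
    (hρ : IsDensity ρ) :
    ergotropy (Λ ρ) qubitHamiltonian ≤ outputErgotropy a b C (energy ρ qubitHamiltonian) := by
  rw [(hΛ.isDensity_map hρ).ergotropy_qubitHamiltonian, hΛ.energy_map hρ, outputErgotropy]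
  exact sub_le_sub_left (monotoneOn_minEig (hΛ.mapsTo hρ.energy_mem_Icc).1 (concurrence_nonneg _)
    (hΛ.le_concurrence_map hρ)) _

theorem exists_energy_sub_minEig_eq (hΛ : HasConvexProfile Λ a b C) {ε : ℝ}
    (hε : ε ∈ Set.Icc (0 : ℝ) 1) : ∃ ρ, IsDensity ρ ∧ energy ρ qubitHamiltonian = ε ∧
      energy (Λ ρ) qubitHamiltonian - minEig (concurrence (Λ ρ)) = outputErgotropy a b C ε := by
  obtain ⟨ρ, hρ, hε, hC⟩ := hΛ.exists_concurrence_map_eq hε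
  exact ⟨ρ, hρ, hε, by rw [hΛ.energy_map hρ, hε, hC, outputErgotropy]⟩

theorem mul_binEntropy_le_sum (hΛ : HasConvexProfile Λ a b C) {n : ℕ} (hn : 0 < n)
    {σ : Fin n → Matrix (Fin 2) (Fin 2) ℂ} (hσ : ∀ t, IsDensity (σ t)) :
    n * binEntropy (minEig (C ((∑ t, energy (σ t) qubitHamiltonian) / n))) ≤
      ∑ t, binEntropy (minEig (concurrence (Λ (σ t)))) := by
  have entropy_convex : ConvexOn ℝ (Set.Icc 0 1) ((binEntropy ∘ minEig) ∘ C) :=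
    convexOn_comp_of_mapsTo convexOn_binEntropy_minEig
      (monotoneOn_binEntropy_minEig.mono Set.Icc_subset_Ici_self) hΛ.convexOn hΛ.mapsTo
  refine (mul_map_average_le_sum entropy_convex hn fun t => (hσ t).energy_mem_Icc).trans
    (Finset.sum_le_sum fun t _ => ?_)
  exact monotoneOn_binEntropy_minEig (hΛ.mapsTo (hσ t).energy_mem_Icc).1 (concurrence_nonneg _)
    (hΛ.le_concurrence_map (hσ t))

theorem extractedWork_tensor_le (hΛ : HasConvexProfile Λ a b C) {n : ℕ} (hn : 0 < n)
    {σ : Fin n → Matrix (Fin 2) (Fin 2) ℂ} (hσ : ∀ t, IsDensity (σ t))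
    {U : Matrix (Fin n → Fin 2) (Fin n → Fin 2) ℂ} (hU : U ∈ Matrix.unitaryGroup _ ℂ) :
    extractedWork U (tensor fun t => Λ (σ t)) (totalHamiltonian qubitHamiltonian n) ≤
      n * outputErgotropy a b C ((∑ t, energy (σ t) qubitHamiltonian) / n) := by
  have hτ (t : Fin n) := hΛ.isDensity_map (hσ t)
  have initial : energy (tensor fun t => Λ (σ t)) (totalHamiltonian qubitHamiltonian n) =
      n * (a + b * ((∑ t, energy (σ t) qubitHamiltonian) / n)) := by
    rw [energy_tensor fun t => (hτ t).2, Finset.sum_congr rfl fun t _ => hΛ.energy_map (hσ t),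
      Finset.sum_add_distrib, ← Finset.mul_sum, Finset.sum_const, Finset.card_univ,
      Fintype.card_fin, nsmul_eq_mul]
    field_simp
  have final := mul_le_energy_conj_tensor hτ (minEig_mem_Icc _) (hΛ.mul_binEntropy_le_sum hn hσ) hU
  rw [extractedWork, initial, outputErgotropy, mul_sub]
  exact sub_le_sub_left final _

theorem mem_hypograph_of_isSeparable (hΛ : HasConvexProfile Λ a b C) {n : ℕ} (hn : 0 < n)
    {ρ U : Matrix (Fin n → Fin 2) (Fin n → Fin 2) ℂ} (hρ : IsSeparable ρ)
    (hU : U ∈ Matrix.unitaryGroup _ ℂ) :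
    energy ρ (totalHamiltonian qubitHamiltonian n) / n ∈ Set.Icc (0 : ℝ) 1 ∧
      extractedWork U (tensorPow Λ n ρ) (totalHamiltonian qubitHamiltonian n) / n ≤
        outputErgotropy a b C (energy ρ (totalHamiltonian qubitHamiltonian n) / n) := by
  have hn' : (0 : ℝ) < n := Nat.cast_pos.mpr hn
  set H := totalHamiltonian qubitHamiltonian n
  let energyAndWork : Matrix (Fin n → Fin 2) (Fin n → Fin 2) ℂ →ₗ[ℝ] ℝ × ℝ :=
    (n : ℝ)⁻¹ • ((isLinearMap_energy H).mk' _).prod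
      ((isLinearMap_extractedWork U H).mk' _ ∘ₗ (isLinearMap_tensorPow Λ n).mk' _)
  have hypograph := hΛ.concaveOn_outputErgotropy.convex_hypograph.linear_preimage energyAndWork
  rw [div_eq_inv_mul, div_eq_inv_mul]
  refine convexHull_min (fun _ hτ => ?_) hypograph hρ
  obtain ⟨σ, hσ, rfl⟩ := hτ
  change (n : ℝ)⁻¹ * energy (tensor σ) H ∈ Set.Icc (0 : ℝ) 1 ∧
    (n : ℝ)⁻¹ * extractedWork U (tensorPow Λ n (tensor σ)) H ≤
      outputErgotropy a b C ((n : ℝ)⁻¹ * energy (tensor σ) H)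
  rw [tensorPow_tensor, energy_tensor fun t => (hσ t).2, inv_mul_le_iff₀ hn', inv_mul_eq_div]
  have average_mem : (∑ t, energy (σ t) qubitHamiltonian) / n ∈ Set.Icc (0 : ℝ) 1 := by
    refine ⟨div_nonneg (Finset.sum_nonneg fun t _ => (hσ t).energy_mem_Icc.1) hn'.le,
      (div_le_one hn').mpr ?_⟩
    simpa using Finset.sum_le_sum fun t (_ : t ∈ Finset.univ) => (hσ t).energy_mem_Icc.2
  exact ⟨average_mem, hΛ.extractedWork_tensor_le hn hσ hU⟩

theorem exists_isMaxOn_outputErgotropy (hΛ : HasConvexProfile Λ a b C) {e : ℝ} (he : 0 ≤ e) :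
    ∃ ε₀ ∈ Set.Icc 0 (min e 1), IsMaxOn (outputErgotropy a b C) (Set.Icc 0 (min e 1)) ε₀ :=
  isCompact_Icc.exists_isMaxOn (Set.nonempty_Icc.mpr (le_min he zero_le_one))
    (hΛ.continuousOn_outputErgotropy.mono (Set.Icc_subset_Icc_right (min_le_right _ _)))

theorem maxErgotropyOne_eq (hΛ : HasConvexProfile Λ a b C) {e ε₀ : ℝ}
    (hε₀ : ε₀ ∈ Set.Icc 0 (min e 1))
    (hmax : IsMaxOn (outputErgotropy a b C) (Set.Icc 0 (min e 1)) ε₀) :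
    maxErgotropyOne Λ qubitHamiltonian e = outputErgotropy a b C ε₀ := by
  obtain ⟨ρ, hρ, hε, hwork⟩ :=
    hΛ.exists_energy_sub_minEig_eq ⟨hε₀.1, hε₀.2.trans (min_le_right _ _)⟩
  refine IsGreatest.csSup_eq ⟨⟨ρ, hρ, hε ▸ hε₀.2.trans (min_le_left _ _), ?_⟩, ?_⟩
  · rw [(hΛ.isDensity_map hρ).ergotropy_qubitHamiltonian, hwork]
  · rintro _ ⟨ρ, hρ, hle, rfl⟩
    exact (hΛ.ergotropy_map_le hρ).trans
      (hmax ⟨hρ.energy_mem_Icc.1, le_min hle hρ.energy_mem_Icc.2⟩)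

theorem chi_eq (hΛ : HasConvexProfile Λ a b C) {e ε₀ : ℝ}
    (hε₀ : ε₀ ∈ Set.Icc 0 (min e 1))
    (hmax : IsMaxOn (outputErgotropy a b C) (Set.Icc 0 (min e 1)) ε₀) :
    chi Λ qubitHamiltonian e = outputErgotropy a b C ε₀ := by
  have h01 : ε₀ ∈ Set.Icc (0 : ℝ) 1 := ⟨hε₀.1, hε₀.2.trans (min_le_right _ _)⟩
  have hε₀_self : ε₀ ∈ Set.Icc 0 (min ε₀ 1) := ⟨h01.1, le_min le_rfl h01.2⟩
  have hmax_self := hmax.on_subset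
    (Set.Icc_subset_Icc_right ((min_le_left ε₀ 1).trans hε₀.2))
  refine IsGreatest.csSup_eq ⟨⟨1, fun _ => 1, fun _ => ε₀, by simp, by simp, fun _ => h01,
    by simpa using hε₀.2.trans (min_le_left _ _),
    by simp [hΛ.maxErgotropyOne_eq hε₀_self hmax_self]⟩, ?_⟩
  rintro _ ⟨k, p, ε, hp, hp1, hε, hle, rfl⟩
  choose ε' hε' hmax' using fun j => hΛ.exists_isMaxOn_outputErgotropy (hε j).1
  have hε'1 (j : Fin k) : ε' j ∈ Set.Icc (0 : ℝ) 1 :=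
    ⟨(hε' j).1, (hε' j).2.trans (min_le_right _ _)⟩
  have mean_mem : ∑ j, p j • ε' j ∈ Set.Icc (0 : ℝ) 1 :=
    (convex_Icc 0 1).sum_mem (fun j _ => hp j) hp1 fun j _ => hε'1 j
  have mean_le : ∑ j, p j • ε' j ≤ e := le_trans (Finset.sum_le_sum fun j _ =>
    mul_le_mul_of_nonneg_left ((hε' j).2.trans (min_le_left _ _)) (hp j)) hle
  calc ∑ j, p j * maxErgotropyOne Λ qubitHamiltonian (ε j)
      = ∑ j, p j • outputErgotropy a b C (ε' j) := by
        simp only [hΛ.maxErgotropyOne_eq (hε' _) (hmax' _), smul_eq_mul]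
    _ ≤ outputErgotropy a b C (∑ j, p j • ε' j) :=
        hΛ.concaveOn_outputErgotropy.le_map_sum (fun j _ => hp j) hp1 fun j _ => hε'1 j
    _ ≤ outputErgotropy a b C ε₀ := hmax ⟨mean_mem.1, le_min mean_le mean_mem.2⟩

theorem extractedWork_le_of_isSeparable (hΛ : HasConvexProfile Λ a b C) {e ε₀ : ℝ}
    (hmax : IsMaxOn (outputErgotropy a b C) (Set.Icc 0 (min e 1)) ε₀) {n : ℕ} (hn : 0 < n)
    {ρ U : Matrix (Fin n → Fin 2) (Fin n → Fin 2) ℂ} (hρ : IsSeparable ρ)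
    (hle : energy ρ (totalHamiltonian qubitHamiltonian n) ≤ n * e)
    (hU : U ∈ Matrix.unitaryGroup _ ℂ) :
    extractedWork U (tensorPow Λ n ρ) (totalHamiltonian qubitHamiltonian n) ≤
      n * outputErgotropy a b C ε₀ := by
  have hn' : (0 : ℝ) < n := Nat.cast_pos.mpr hn
  obtain ⟨hmem, hwork⟩ := hΛ.mem_hypograph_of_isSeparable hn hρ hU
  exact (div_le_iff₀' hn').mp
    (hwork.trans (hmax ⟨hmem.1, le_min ((div_le_iff₀' hn').mpr hle) hmem.2⟩))

theorem maxErgotropySep_eq (hΛ : HasConvexProfile Λ a b C) {e ε₀ : ℝ}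
    (hε₀ : ε₀ ∈ Set.Icc 0 (min e 1))
    (hmax : IsMaxOn (outputErgotropy a b C) (Set.Icc 0 (min e 1)) ε₀)
    {n : ℕ} (hn : 0 < n) :
    maxErgotropySep Λ qubitHamiltonian n (n * e) = n * outputErgotropy a b C ε₀ := by
  have hn' : (0 : ℝ) < n := Nat.cast_pos.mpr hn
  obtain ⟨ρ, hρ, hε, hopt⟩ :=
    hΛ.exists_energy_sub_minEig_eq ⟨hε₀.1, hε₀.2.trans (min_le_right _ _)⟩
  obtain ⟨U, hU, hwork⟩ := (hΛ.isDensity_map hρ).exists_extractedWork_eq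
  have copies_sep : IsSeparable (tensor fun _ : Fin n => ρ) :=
    subset_convexHull ℝ _ ⟨_, fun _ => hρ, rfl⟩
  have copies_energy : energy (tensor fun _ : Fin n => ρ)
      (totalHamiltonian qubitHamiltonian n) ≤ n * e := by
    rw [energy_tensor fun _ => hρ.2, hε]
    simpa using mul_le_mul_of_nonneg_left (hε₀.2.trans (min_le_left _ _)) hn'.le
  have copies_work : extractedWork (tensor fun _ => U) (tensorPow Λ n (tensor fun _ => ρ))
      (totalHamiltonian qubitHamiltonian n) = n * outputErgotropy a b C ε₀ := by
    rw [tensorPow_tensor, extractedWork_tensor hU (hΛ.isDensity_map hρ).2, hwork, hopt]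
  refine IsGreatest.csSup_eq ⟨⟨_, copies_sep, copies_energy, ?_⟩, ?_⟩
  · rw [ergotropy_eq_of_forall_le (tensor_mem_unitaryGroup fun _ => hU) fun V hV => ?_,
      copies_work]
    rw [copies_work]
    exact hΛ.extractedWork_le_of_isSeparable hmax hn copies_sep copies_energy hV
  · rintro _ ⟨ρ, hρ, hle, rfl⟩
    exact ergotropy_le fun V hV => hΛ.extractedWork_le_of_isSeparable hmax hn hρ hle hV

theorem tendsto_maxErgotropySep (hΛ : HasConvexProfile Λ a b C) {e : ℝ} (he : 0 ≤ e) :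
    Tendsto (fun n : ℕ => maxErgotropySep Λ qubitHamiltonian n (n * e) / n) atTop
      (𝓝 (chi Λ qubitHamiltonian e)) := by
  obtain ⟨ε₀, hε₀, hmax⟩ := hΛ.exists_isMaxOn_outputErgotropy he
  refine tendsto_const_nhds.congr' ?_
  filter_upwards [eventually_gt_atTop 0] with n hn
  rw [hΛ.maxErgotropySep_eq hε₀ hmax hn, hΛ.chi_eq hε₀ hmax,
    mul_div_cancel_left₀ _ (Nat.cast_ne_zero.mpr hn.ne')]

end HasConvexProfile

end Channel

section Damping

variable {γ η ε : ℝ} {ρ : Matrix (Fin 2) (Fin 2) ℂ}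

theorem trace_gadc (γ η : ℝ) (ρ : Matrix (Fin 2) (Fin 2) ℂ) : (gadc γ η ρ).trace = ρ.trace := by
  simp only [gadc, LinearMap.coe_mk, AddHom.coe_mk, Matrix.trace_fin_two_of]
  ring

theorem isHermitian_gadc (γ η : ℝ) (hρ : ρ.IsHermitian) : (gadc γ η ρ).IsHermitian := by
  have h00 : (starRingEnd ℂ) (ρ 0 0) = ρ 0 0 := hρ.apply 0 0
  have h11 : (starRingEnd ℂ) (ρ 1 1) = ρ 1 1 := hρ.apply 1 1
  have h01 : (starRingEnd ℂ) (ρ 1 0) = ρ 0 1 := hρ.apply 0 1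
  have h10 : (starRingEnd ℂ) (ρ 0 1) = ρ 1 0 := hρ.apply 1 0
  ext i j
  fin_cases i <;> fin_cases j <;> simp [gadc, Matrix.trace_fin_two, h00, h11, h01, h10]

theorem energy_gadc (γ η : ℝ) (htr : ρ.trace = 1) :
    energy (gadc γ η ρ) qubitHamiltonian = γ * η + (1 - γ) * energy ρ qubitHamiltonian := by
  rw [gadc_of_trace_eq_one γ η ρ htr, energy_qubitHamiltonian, energy_qubitHamiltonian]
  simp

/-- The determinant of the output of `gadc γ η` on a pure state of energy `ε`. -/
def pureOutputDet (γ η ε : ℝ) : ℝ := (1 - γ) * γ * (ε - η) ^ 2 + γ * η * (1 - η)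

theorem pureOutputDet_nonneg (hγ : γ ∈ Set.Icc (0 : ℝ) 1) (hη : η ∈ Set.Icc (0 : ℝ) 1) (ε : ℝ) :
    0 ≤ pureOutputDet γ η ε := by
  have := hγ.1
  have := sub_nonneg.mpr hγ.2
  have := hη.1
  have := sub_nonneg.mpr hη.2
  unfold pureOutputDet
  positivity

theorem det_re_gadc (hγ : γ ≤ 1) (η : ℝ) (hρ : ρ.IsHermitian) (htr : ρ.trace = 1) :
    (gadc γ η ρ).det.re =
      pureOutputDet γ η (energy ρ qubitHamiltonian) + (1 - γ) * ρ.det.re := by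
  have excited : (ρ 1 1).im = 0 := Complex.conj_eq_iff_im.mp (hρ.apply 1 1)
  have ground : ρ 0 0 = 1 - ρ 1 1 := by
    rw [← htr, Matrix.trace_fin_two]
    ring
  have hsqrt : √(1 - γ) * √(1 - γ) = 1 - γ := Real.mul_self_sqrt (sub_nonneg.mpr hγ)
  rw [gadc_of_trace_eq_one γ η ρ htr, energy_qubitHamiltonian, Matrix.det_fin_two_of,
    Matrix.det_fin_two, ground, pureOutputDet]
  simp only [Complex.sub_re, Complex.mul_re, Complex.add_re, Complex.one_re, Complex.ofReal_re,
    Complex.sub_im, Complex.mul_im, Complex.add_im, Complex.one_im, Complex.ofReal_im, excited]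
  linear_combination ((ρ 0 1).im * (ρ 1 0).im - (ρ 0 1).re * (ρ 1 0).re) * hsqrt

/-- The least output concurrence of `gadc γ η` at input energy `ε`. -/
noncomputable def gadcConcurrence (γ η ε : ℝ) : ℝ := 2 * √(pureOutputDet γ η ε)

theorem convexOn_gadcConcurrence (hγ : γ ∈ Set.Icc (0 : ℝ) 1) (hη : η ∈ Set.Icc (0 : ℝ) 1) :
    ConvexOn ℝ Set.univ (gadcConcurrence γ η) := by
  have hγγ : 0 ≤ (1 - γ) * γ := mul_nonneg (sub_nonneg.mpr hγ.2) hγ.1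
  have hγη : 0 ≤ γ * η * (1 - η) := mul_nonneg (mul_nonneg hγ.1 hη.1) (sub_nonneg.mpr hη.2)
  let z : ℝ →ᵃ[ℝ] ℂ := AffineMap.lineMap
    ⟨-(√((1 - γ) * γ) * η), √(γ * η * (1 - η))⟩
    ⟨√((1 - γ) * γ) * (1 - η), √(γ * η * (1 - η))⟩
  have norm_form : gadcConcurrence γ η = fun ε => 2 * ‖z ε‖ := by
    funext ε
    have hz : z ε = ⟨√((1 - γ) * γ) * (ε - η), √(γ * η * (1 - η))⟩ := by
      apply Complex.ext <;>
        simp only [z, AffineMap.lineMap_apply, vsub_eq_sub, vadd_eq_add, Complex.real_smul,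
          Complex.add_re, Complex.add_im, Complex.sub_re, Complex.sub_im, Complex.mul_re,
          Complex.mul_im, Complex.ofReal_re, Complex.ofReal_im] <;>
        ring
    rw [hz, Complex.norm_def, Complex.normSq_mk, Real.mul_self_sqrt hγη, mul_mul_mul_comm,
      Real.mul_self_sqrt hγγ, ← sq, gadcConcurrence, pureOutputDet]
  rw [norm_form]
  exact (convexOn_univ_norm.comp_affineMap z).smul zero_le_two

theorem continuous_gadcConcurrence (γ η : ℝ) : Continuous (gadcConcurrence γ η) := by
  unfold gadcConcurrence pureOutputDet
  fun_prop

/-- The pure qubit state of energy `ε ∈ [0, 1]` with real nonnegative coherence. -/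
noncomputable def pureState (ε : ℝ) : Matrix (Fin 2) (Fin 2) ℂ :=
  Matrix.vecMulVec ![(√(1 - ε) : ℂ), (√ε : ℂ)] (star ![(√(1 - ε) : ℂ), (√ε : ℂ)])

theorem isDensity_pureState (hε : ε ∈ Set.Icc (0 : ℝ) 1) : IsDensity (pureState ε) := by
  refine ⟨Matrix.posSemidef_vecMulVec_self_star _, ?_⟩
  rw [Matrix.trace_fin_two, pureState, Matrix.vecMulVec_apply, Matrix.vecMulVec_apply]
  simp [← Complex.ofReal_mul, Real.mul_self_sqrt hε.1, Real.mul_self_sqrt (sub_nonneg.mpr hε.2)]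

theorem energy_pureState (hε : 0 ≤ ε) : energy (pureState ε) qubitHamiltonian = ε := by
  rw [energy_qubitHamiltonian, pureState, Matrix.vecMulVec_apply]
  simp [Real.mul_self_sqrt hε]

theorem det_pureState (ε : ℝ) : (pureState ε).det = 0 :=
  Matrix.det_vecMulVec _ _

theorem isDensity_gadc (hγ : γ ∈ Set.Icc (0 : ℝ) 1) (hη : η ∈ Set.Icc (0 : ℝ) 1)
    (hρ : IsDensity ρ) : IsDensity (gadc γ η ρ) := by
  refine isDensity_of_det_nonneg (isHermitian_gadc γ η hρ.1.isHermitian)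
    ((trace_gadc γ η ρ).trans hρ.2) ?_
  rw [det_re_gadc hγ.2 η hρ.1.isHermitian hρ.2]
  exact add_nonneg (pureOutputDet_nonneg hγ hη _)
    (mul_nonneg (sub_nonneg.mpr hγ.2) hρ.det_re_nonneg)

theorem gadcConcurrence_le (hγ : γ ≤ 1) (η : ℝ) (hρ : IsDensity ρ) :
    gadcConcurrence γ η (energy ρ qubitHamiltonian) ≤ concurrence (gadc γ η ρ) := by
  rw [gadcConcurrence, concurrence, det_re_gadc hγ η hρ.1.isHermitian hρ.2]
  gcongr
  exact le_add_of_nonneg_right (mul_nonneg (sub_nonneg.mpr hγ) hρ.det_re_nonneg)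

theorem concurrence_gadc_pureState (hγ : γ ≤ 1) (η : ℝ) (hε : ε ∈ Set.Icc (0 : ℝ) 1) :
    concurrence (gadc γ η (pureState ε)) = gadcConcurrence γ η ε := by
  have hρ := isDensity_pureState hε
  rw [concurrence, det_re_gadc hγ η hρ.1.isHermitian hρ.2, det_pureState, energy_pureState hε.1,
    Complex.zero_re, mul_zero, add_zero, gadcConcurrence]

theorem hasConvexProfile_gadc (hγ : γ ∈ Set.Icc (0 : ℝ) 1) (hη : η ∈ Set.Icc (0 : ℝ) 1) :
    HasConvexProfile (gadc γ η) (γ * η) (1 - γ) (gadcConcurrence γ η) where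
  isDensity_map hρ := isDensity_gadc hγ hη hρ
  energy_map hρ := energy_gadc γ η hρ.2
  le_concurrence_map hρ := gadcConcurrence_le hγ.2 η hρ
  exists_concurrence_map_eq hε := ⟨pureState _, isDensity_pureState hε, energy_pureState hε.1,
    concurrence_gadc_pureState hγ.2 η hε⟩
  convexOn := (convexOn_gadcConcurrence hγ hη).subset (Set.subset_univ _) (convex_Icc 0 1)
  continuousOn := (continuous_gadcConcurrence γ η).continuousOn

end Damping

end QBattery

theorem mainTheorem5_general {γ η e : ℝ} (hγ : γ ∈ Set.Icc (0 : ℝ) 1) (hη : η ∈ Set.Icc (0 : ℝ) 1)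
    (he : 0 ≤ e) :
    Tendsto
        (fun n : ℕ =>
          QBattery.maxErgotropySep (QBattery.gadc γ η) QBattery.qubitHamiltonian n (n * e) / n)
        atTop
        (𝓝 (QBattery.sepCapacitance (QBattery.gadc γ η) QBattery.qubitHamiltonian e)) ∧
      QBattery.sepCapacitance (QBattery.gadc γ η) QBattery.qubitHamiltonian e =
        QBattery.chi (QBattery.gadc γ η) QBattery.qubitHamiltonian e := by
  have converges := (QBattery.hasConvexProfile_gadc hγ hη).tendsto_maxErgotropySep he
  have capacitance_eq : QBattery.sepCapacitance (QBattery.gadc γ η) QBattery.qubitHamiltonian e =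
      QBattery.chi (QBattery.gadc γ η) QBattery.qubitHamiltonian e := converges.limUnder_eq
  exact ⟨capacitance_eq ▸ converges, capacitance_eq⟩

theorem mainTheorem5 :
    (∀ γ ∈ Set.Icc (0 : ℝ) 1, ∀ η ∈ Set.Icc (0 : ℝ) (1 / 2), ∀ e ∈ Set.Icc (0 : ℝ) 1,
      Tendsto
          (fun n : ℕ =>
            QBattery.maxErgotropySep (QBattery.gadc γ η) QBattery.qubitHamiltonian n (n * e) / n)
          atTop
          (𝓝 (QBattery.sepCapacitance (QBattery.gadc γ η) QBattery.qubitHamiltonian e)) ∧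
        QBattery.sepCapacitance (QBattery.gadc γ η) QBattery.qubitHamiltonian e =
          QBattery.chi (QBattery.gadc γ η) QBattery.qubitHamiltonian e) ∧
    (∀ γ ∈ Set.Icc (0 : ℝ) 1, ∀ e ∈ Set.Icc (0 : ℝ) 1,
      Tendsto
          (fun n : ℕ =>
            QBattery.maxErgotropySep (QBattery.adc γ) QBattery.qubitHamiltonian n (n * e) / n)
          atTop
          (𝓝 (QBattery.sepCapacitance (QBattery.adc γ) QBattery.qubitHamiltonian e)) ∧
        QBattery.sepCapacitance (QBattery.adc γ) QBattery.qubitHamiltonian e =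
          QBattery.chi (QBattery.adc γ) QBattery.qubitHamiltonian e) :=
  ⟨fun _ hγ _ hη _ he =>
      mainTheorem5_general hγ ⟨hη.1, hη.2.trans one_half_lt_one.le⟩ he.1,
    fun γ hγ _ he => QBattery.gadc_zero γ ▸ mainTheorem5_general hγ ⟨le_rfl, zero_le_one⟩ he.1⟩
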